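/- **Setting.** A test on a measurable space $X$ is a measurable function $g:X\to[0,1]$ (the probability of rejecting). For probability measures $P,Q$ on $X$ the trade-off function is $T_{P,Q}(\alpha)=\inf\{\int(1-g)\,dQ : g \text{ a test with } \int g\,dP\le\alpha\}$, $\alpha\in[0,1]$. For two continuous probability densities $p,q$ on $\mathbb R^d$, $h>0$ and $\eta\in\mathbb R$, the perturbed likelihood ratio test rejects if $q/p>\eta+x$ with $x$ uniform on $[-h/2,h/2]$. Its type-I and type-II errors are $$\alpha_h^{p,q}(\eta)=\int_{-h/2}^{h/2}\frac1h\int_{\{q/p>\eta+x\}}p\,dx,\qquad \beta_h^{p,q}(\eta)=\int_{-h/2}^{h/2}\frac1h\int_{\{q/p\le\eta+x\}}q\,dx ,$$ where $q/p=+\infty$ if $p=0<q$ (points with $p=q=0$ do not matter). Its curve $T_h^{p,q}$ is defined by $T_h^{p,q}(\alpha)=\beta_h^{p,q}(\eta)$ if $\alpha=\alpha_h^{p,q}(\eta)$; this does not depend on the choice of $\eta$. **Assumptions.** Let $p,q$ be continuous probability densities on $\mathbb R^d$ such that $\{q/p=\eta\}$ has positive mass for only finitely many $\eta\ge0$, and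 let $T$ be the trade-off function of the two distributions with densities $p,q$. Let $\hat p=\hat p_n$, $\hat q=\hat q_n$ be random functions on a probability space whose realizations are continuous probability densities on $\mathbb R^d$ tending to $0$ at infinity, such that for some $a_n\ge0$ with $a_n\to0$, $$\Pr\big[\sup_y|\hat p_n(y)-p(y)|>a_n\big]\to0,\qquad \Pr\big[\sup_y|\hat q_n(y)-q(y)|>a_n\big]\to0 .$$ Let $h=h_n>0$ with $h_n\to0$ and $h_n/a_n\to\infty$ (that is, $a_n/h_n\to0$; $a_n=0$ is allowed). Write $\hat\alpha_h=\alpha_{h_n}^{\hat p_n,\hat q_n}$ and $\hat T_h=T_{h_n}^{\hat p_n,\hat q_n}$. Let $T^{(0)}$ be the trade-off function of some pair of probability measures (on any measurable space). Let $\hat\eta^*=\hat\eta^*_n$ be real-valued and such that, with probability tending to one, $$\hat\eta^*\in\operatorname{argmax}\big\{T^{(0)}(\hat\alpha_h(\eta))-\hat T_h(\hat\alpha_h(\eta)):\eta\ge0\big\}.$$ **Proposition.** As $n\to\infty$, $$T^{(0)}(\hat\alpha_h(\hat\eta^*))-T(\hat\alpha_h(\hat\eta^*))=\sup_{\alpha\in[0,1]}\big[T^{(0)}(\alpha)-T(\alpha)\big]+o_P(1),$$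 where $o_P(1)$ denotes a sequence converging to $0$ in probability. -/

import Mathlib

open MeasureTheory Filter Topology Set

noncomputable section

namespace FDP

/-! ### Tests and trade-off functions -/

/-- A (possibly randomized) test on `X`, given by its rejection probability: if `x` is observed,
the null hypothesis is rejected with probability `g x`. -/
structure IsTest {X : Type*} [MeasurableSpace X] (g : X → ℝ) : Prop where
  measurable : Measurable g
  nonneg : ∀ x, 0 ≤ g x
  le_one : ∀ x, g x ≤ 1

/-- The type-I error of the test `g` for the null hypothesis `P`. -/
def typeI {X : Type*} [MeasurableSpace X] (P : Measure X) (g : X → ℝ) : ℝ :=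
  ∫ x, g x ∂P

/-- The type-II error of the test `g` for the alternative `Q`. -/
def typeII {X : Type*} [MeasurableSpace X] (Q : Measure X) (g : X → ℝ) : ℝ :=
  ∫ x, (1 - g x) ∂Q

/-- The trade-off function of `P` and `Q`: the infimum of the type-II errors of all tests of
type-I error at most `α`. -/
def tradeOff {X : Type*} [MeasurableSpace X] (P Q : Measure X) (α : ℝ) : ℝ :=
  sInf {β : ℝ | ∃ g : X → ℝ, IsTest g ∧ typeI P g ≤ α ∧ β = typeII Q g}

/-! ### Continuous densities on `ℝ^d` -/

/-- `p` is a continuous probability density (with respect to Lebesgue measure) on `ℝ^d`. -/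
structure IsContDensity {d : ℕ} (p : EuclideanSpace ℝ (Fin d) → ℝ) : Prop where
  continuous : Continuous p
  nonneg : ∀ y, 0 ≤ p y
  integrable : Integrable p
  integral_eq_one : ∫ y, p y = 1

/-- The distribution on `ℝ^d` with Lebesgue density `p`. -/
def distOf {d : ℕ} (p : EuclideanSpace ℝ (Fin d) → ℝ) : Measure (EuclideanSpace ℝ (Fin d)) :=
  volume.withDensity fun y => ENNReal.ofReal (p y)

/-- The values `η ≥ 0` such that the level set `{q / p = η}` has positive mass under `p`.
(Points with `p = 0` are null for `p`. As `q = η p` on the level set, it has positive mass under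
`p` as soon as it has positive mass under `q`.) -/
def plateauValues {d : ℕ} (p q : EuclideanSpace ℝ (Fin d) → ℝ) : Set ℝ :=
  {η : ℝ | 0 ≤ η ∧ 0 < distOf p {y | 0 < p y ∧ q y / p y = η}}

/-! ### The perturbed likelihood ratio test -/

/-- The set `{q / p > t}`. It is written without division, so that a point with `p y = 0 < q y`
counts as a point of ratio `+∞` (points with `p y = q y = 0` carry no mass). -/
def rejectSet {d : ℕ} (p q : EuclideanSpace ℝ (Fin d) → ℝ) (t : ℝ) :
    Set (EuclideanSpace ℝ (Fin d)) :=
  {y | t * p y < q y}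

/-- Type-I error of the perturbed likelihood ratio test for the densities `p, q`, which rejects if
`q / p > η + x`, with `x` uniformly distributed on `[-h/2, h/2]`. -/
def alphaPert {d : ℕ} (p q : EuclideanSpace ℝ (Fin d) → ℝ) (h η : ℝ) : ℝ :=
  ∫ x in Icc (-h / 2) (h / 2), (1 / h) * ∫ y in rejectSet p q (η + x), p y

/-- Type-II error of the perturbed likelihood ratio test: the probability under `q` of not
rejecting. -/
def betaPert {d : ℕ} (p q : EuclideanSpace ℝ (Fin d) → ℝ) (h η : ℝ) : ℝ :=
  ∫ x in Icc (-h / 2) (h / 2), (1 / h) * ∫ y in (rejectSet p q (η + x))ᶜ, q y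

/-- The curve of the perturbed likelihood ratio test: its value at `α` is `betaPert p q h η` if
`α = alphaPert p q h η`. By `tradeOffPert_alphaPert` below, this value does not depend on the
choice of `η`, so that the set is a singleton whenever `α` is attained. -/
def tradeOffPert {d : ℕ} (p q : EuclideanSpace ℝ (Fin d) → ℝ) (h α : ℝ) : ℝ :=
  sInf {β : ℝ | ∃ η : ℝ, α = alphaPert p q h η ∧ β = betaPert p q h η}

section WellDefined

variable {d : ℕ} {p q : EuclideanSpace ℝ (Fin d) → ℝ}

theorem measurableSet_rejectSet (hp : IsContDensity p) (hq : IsContDensity q) (t : ℝ) :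
    MeasurableSet (rejectSet p q t) :=
  (isOpen_lt (continuous_const.mul hp.continuous) hq.continuous).measurableSet

theorem rejectSet_anti (hp : IsContDensity p) {s t : ℝ} (hst : s ≤ t) :
    rejectSet p q t ⊆ rejectSet p q s := fun y hy =>
  lt_of_le_of_lt (mul_le_mul_of_nonneg_right hst (hp.nonneg y)) hy

theorem antitone_inner (hp : IsContDensity p) :
    Antitone fun t => ∫ y in rejectSet p q t, p y := fun _ _ hst =>
  setIntegral_mono_set hp.integrable.integrableOn
    (Eventually.of_forall hp.nonneg) (rejectSet_anti hp hst).eventuallyLE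

theorem inner_compl_eq (hp : IsContDensity p) (hq : IsContDensity q) {s t : ℝ} (hst : s ≤ t)
    (h : ∫ y in rejectSet p q s, p y = ∫ y in rejectSet p q t, p y) :
    ∫ y in (rejectSet p q s)ᶜ, q y = ∫ y in (rejectSet p q t)ᶜ, q y := by
  have hms := measurableSet_rejectSet hp hq s
  have hmt := measurableSet_rejectSet hp hq t
  have hsub := rejectSet_anti (q := q) hp hst
  have h0 : ∫ y in rejectSet p q s \ rejectSet p q t, p y = 0 := by
    rw [setIntegral_sdiff hmt hp.integrable.integrableOn hsub, h, sub_self]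
  have hz := (setIntegral_eq_zero_iff_of_nonneg_ae
    (Eventually.of_forall hp.nonneg) hp.integrable.integrableOn).1 h0
  have hqz : ∫ y in rejectSet p q s \ rejectSet p q t, q y = 0 := by
    apply integral_eq_zero_of_ae
    filter_upwards [hz, ae_restrict_mem (hms.diff hmt)] with y hy hmem
    have h1 : ¬ t * p y < q y := hmem.2
    have h2 : p y = 0 := hy
    rw [h2, mul_zero] at h1
    exact le_antisymm (not_lt.1 h1) (hq.nonneg y)
  rw [setIntegral_sdiff hmt hq.integrable.integrableOn hsub] at hqz
  have e1 := integral_add_compl hms hq.integrable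
  have e2 := integral_add_compl hmt hq.integrable
  linarith

theorem betaPert_eq_of_le (hp : IsContDensity p) (hq : IsContDensity q) {h : ℝ} (hh : 0 < h)
    {η η' : ℝ} (hle : η ≤ η') (he : alphaPert p q h η = alphaPert p q h η') :
    betaPert p q h η = betaPert p q h η' := by
  have hint : ∀ c : ℝ, IntegrableOn
      (fun x => (1 / h) * ∫ y in rejectSet p q (c + x), p y) (Icc (-h / 2) (h / 2)) := by
    intro c
    refine AntitoneOn.integrableOn_isCompact isCompact_Icc ?_
    intro x _ y _ hxy
    exact mul_le_mul_of_nonneg_left (antitone_inner hp (by linarith)) (by positivity)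
  have hnn : ∀ x, 0 ≤ (1 / h) * (∫ y in rejectSet p q (η + x), p y)
      - (1 / h) * ∫ y in rejectSet p q (η' + x), p y := fun x =>
    sub_nonneg.2 (mul_le_mul_of_nonneg_left
      (antitone_inner hp (by linarith)) (by positivity))
  have h0 : ∫ x in Icc (-h / 2) (h / 2), ((1 / h) * (∫ y in rejectSet p q (η + x), p y)
      - (1 / h) * ∫ y in rejectSet p q (η' + x), p y) = 0 := by
    rw [integral_sub (hint η) (hint η')]
    exact sub_eq_zero.2 he
  have hz := (setIntegral_eq_zero_iff_of_nonneg_ae (Eventually.of_forall hnn)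
    ((hint η).sub (hint η'))).1 h0
  apply integral_congr_ae
  filter_upwards [hz] with x hx
  have hx' : (1 / h) * (∫ y in rejectSet p q (η + x), p y)
      = (1 / h) * ∫ y in rejectSet p q (η' + x), p y := sub_eq_zero.1 hx
  have hx2 := mul_left_cancel₀ (by positivity : (1 / h : ℝ) ≠ 0) hx'
  rw [inner_compl_eq hp hq (by linarith) hx2]

/-- The curve of the perturbed likelihood ratio test is well defined. -/
theorem tradeOffPert_alphaPert (hp : IsContDensity p) (hq : IsContDensity q) {h : ℝ}
    (hh : 0 < h) (η : ℝ) : tradeOffPert p q h (alphaPert p q h η) = betaPert p q h η := by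
  have hset : {β : ℝ | ∃ η' : ℝ, alphaPert p q h η = alphaPert p q h η' ∧
      β = betaPert p q h η'} = {betaPert p q h η} := by
    ext β
    constructor
    · rintro ⟨η', he, rfl⟩
      rcases le_total η η' with hle | hle
      · exact (betaPert_eq_of_le hp hq hh hle he).symm
      · exact betaPert_eq_of_le hp hq hh hle he.symm
    · rintro rfl
      exact ⟨η, rfl, rfl⟩
  rw [tradeOffPert, hset, csInf_singleton]

end WellDefined

/-! ### The estimators and the estimated threshold -/

/-- `phat n` (a random function) is an estimator of `p` whose realizations are continuous
probability densities that decay to `0` at infinity, and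
`Pr[sup_y |phat n y - p y| > a n] → 0`. -/
structure IsDensityEstimator {d : ℕ} {Ω : Type*} [MeasurableSpace Ω] (μ : Measure Ω)
    (phat : ℕ → Ω → EuclideanSpace ℝ (Fin d) → ℝ) (p : EuclideanSpace ℝ (Fin d) → ℝ)
    (a : ℕ → ℝ) : Prop where
  density : ∀ n ω, IsContDensity (phat n ω)
  decay : ∀ n ω, Tendsto (phat n ω) (cocompact (EuclideanSpace ℝ (Fin d))) (𝓝 0)
  rate : Tendsto
    (fun n => μ {ω | ENNReal.ofReal (a n) < ⨆ y, ENNReal.ofReal |phat n ω y - p y|})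
    atTop (𝓝 0)

/-- The set of maximizers over `η ≥ 0` of `T₀(α_h(η)) - T_h(α_h(η))`, where `α_h` and `T_h` are the
type-I error and the curve of the perturbed likelihood ratio test for `p, q`. -/
def argmaxGap {d : ℕ} (T₀ : ℝ → ℝ) (p q : EuclideanSpace ℝ (Fin d) → ℝ) (h : ℝ) : Set ℝ :=
  {η : ℝ | 0 ≤ η ∧ ∀ η' : ℝ, 0 ≤ η' →
    T₀ (alphaPert p q h η') - tradeOffPert p q h (alphaPert p q h η') ≤
      T₀ (alphaPert p q h η) - tradeOffPert p q h (alphaPert p q h η)}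

end FDP

end

/-!
The argument is a deterministic statement about `L¹` approximation,
`FDP.exists_abs_gap_sub_iSup_le`, applied outside three events of vanishing probability. Uniform
closeness of densities gives `L¹` closeness (`FDP.integral_abs_sub_le`): both integrals are `1`, so
only the positive part of `p - phat` has to be controlled, it is dominated by `min p a`, and
`∫ min p a → 0` by dominated convergence.

Write `α̂(η)`, `β̂(η)` for the errors of the perturbed test built from `phat, qhat`, and `T` for the
trade-off function of `p, q`. Two inequalities relate the estimated curve to `T`.

* `FDP.tradeOff_le_betaPert_add`: the perturbed test is a randomized test (Fubini), and its errors
  for `p, q` differ from those for `phat, qhat` by at most the `L¹` distances. Hence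
  `T(α̂(η)) ≤ β̂(η) + o(1)`, uniformly in `η`.
* `FDP.betaPert_le_tradeOff_add`: averaging the Neyman–Pearson inequality over the perturbation
  shows that the perturbed test with `η ≥ 0` is optimal up to `h / 2` for `phat, qhat`
  (`FDP.betaPert_le`). Hence `β̂(η) ≤ T(α̂(η)) + o(1)`, uniformly in `η ≥ 0` with `α̂(η) ≥ δ`.

The second inequality can fail near level `0`: there `qhat` may have a bounded likelihood ratio with
respect to `phat` although `q` has a singular part with respect to `p`. This is harmless, since
trade-off functions are uniformly continuous on `[0, 1]` (`FDP.exists_tradeOff_le_add`), including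
at `0`, so that the supremum of the gap is nearly attained at levels above `δ`. The perturbation
makes `α̂` continuous in `η`, so all levels in `(0, α̂(0)]` occur for some `η ≥ 0`; levels above
`α̂(0)` do no better than `α̂(0)`, because `β̂(0) ≤ h / 2`. The first inequality at the maximizer and
the second at its competitors then give the claim.
-/

open MeasureTheory Filter Topology Set

noncomputable section

namespace FDP

/-! ### Trade-off functions are uniformly continuous -/

section TradeOff

variable {X : Type*} [MeasurableSpace X]

theorem IsTest.integrable {g : X → ℝ} (hg : IsTest g) (P : Measure X) [IsFiniteMeasure P] :
    Integrable g P := by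
  refine Integrable.of_bound hg.measurable.aestronglyMeasurable 1 (Eventually.of_forall fun x => ?_)
  rw [Real.norm_eq_abs, abs_of_nonneg (hg.nonneg x)]
  exact hg.le_one x

theorem IsTest.const {c : ℝ} (h0 : 0 ≤ c) (h1 : c ≤ 1) : IsTest fun _ : X => c :=
  ⟨measurable_const, fun _ => h0, fun _ => h1⟩

theorem IsTest.const_mul {g : X → ℝ} (hg : IsTest g) {c : ℝ} (h0 : 0 ≤ c) (h1 : c ≤ 1) :
    IsTest fun x => c * g x :=
  ⟨hg.measurable.const_mul c, fun x => mul_nonneg h0 (hg.nonneg x),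
    fun x => mul_le_one₀ h1 (hg.nonneg x) (hg.le_one x)⟩

theorem typeII_nonneg {g : X → ℝ} (hg : IsTest g) (Q : Measure X) : 0 ≤ typeII Q g :=
  integral_nonneg fun x => sub_nonneg.2 (hg.le_one x)

theorem typeII_eq {g : X → ℝ} (hg : IsTest g) (Q : Measure X) [IsProbabilityMeasure Q] :
    typeII Q g = 1 - typeI Q g := by
  rw [typeII, integral_sub (integrable_const _) (hg.integrable Q)]
  simp [typeI]

theorem typeI_nonneg {g : X → ℝ} (hg : IsTest g) (P : Measure X) : 0 ≤ typeI P g :=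
  integral_nonneg hg.nonneg

theorem typeI_le_one {g : X → ℝ} (hg : IsTest g) (P : Measure X) [IsProbabilityMeasure P] :
    typeI P g ≤ 1 := by
  have := typeII_nonneg hg P
  rw [typeII_eq hg] at this
  linarith

variable (P Q : Measure X)

theorem tradeOff_le {g : X → ℝ} (hg : IsTest g) {α : ℝ} (h : typeI P g ≤ α) :
    tradeOff P Q α ≤ typeII Q g := by
  refine csInf_le ⟨0, ?_⟩ ⟨g, hg, h, rfl⟩
  rintro _ ⟨g, hg, -, rfl⟩
  exact typeII_nonneg hg Q

theorem le_tradeOff {α c : ℝ} (hα : 0 ≤ α)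
    (h : ∀ g : X → ℝ, IsTest g → typeI P g ≤ α → c ≤ typeII Q g) : c ≤ tradeOff P Q α := by
  refine le_csInf ⟨_, fun _ => 0, IsTest.const le_rfl zero_le_one, by simpa [typeI], rfl⟩ ?_
  rintro _ ⟨g, hg, hgα, rfl⟩
  exact h g hg hgα

theorem tradeOff_nonneg {α : ℝ} (hα : 0 ≤ α) : 0 ≤ tradeOff P Q α :=
  le_tradeOff P Q hα fun _ hg _ => typeII_nonneg hg Q

theorem tradeOff_le_one [IsProbabilityMeasure Q] {α : ℝ} (hα : 0 ≤ α) : tradeOff P Q α ≤ 1 := by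
  have h := tradeOff_le P Q (IsTest.const (X := X) le_rfl zero_le_one) (α := α) (by simpa [typeI])
  simpa [typeII] using h

theorem tradeOff_anti {α α' : ℝ} (hα : 0 ≤ α) (h : α ≤ α') : tradeOff P Q α' ≤ tradeOff P Q α :=
  le_tradeOff P Q hα fun _ hg hgα => tradeOff_le P Q hg (hgα.trans h)

variable [IsProbabilityMeasure P] [IsProbabilityMeasure Q]

/-- A trade-off function is right-continuous at `0`. If tests with summable type-I errors had
type-II errors bounded away from `tradeOff P Q 0`, then their upper limit would be a test of type-I
error `0` (the tests tend to `0` almost surely under `P`) which, by the reverse Fatou lemma, has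
type-II error below `tradeOff P Q 0`. -/
theorem exists_tradeOff_zero_le {ε : ℝ} (hε : 0 < ε) :
    ∃ δ > 0, tradeOff P Q 0 ≤ tradeOff P Q δ + ε := by
  by_contra! hcon
  have hex : ∀ n : ℕ, ∃ g : X → ℝ, IsTest g ∧ typeI P g ≤ (1 / 2) ^ n ∧
      typeII Q g < tradeOff P Q 0 - ε := by
    intro n
    by_contra! hn
    have h1 := hcon ((1 / 2) ^ n) (by positivity)
    have h2 := le_tradeOff P Q (by positivity) hn
    linarith
  choose g hg hgP hgQ using hex
  have hfm : ∀ n, Measurable fun x => ENNReal.ofReal (g n x) := fun n =>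
    (hg n).measurable.ennreal_ofReal
  set L : X → ENNReal := fun x => limsup (fun n => ENNReal.ofReal (g n x)) atTop with hL
  have hLm : Measurable L := Measurable.limsup hfm
  have hL1 : ∀ x, L x ≤ 1 := fun x => by
    refine limsup_le_of_le (h := Eventually.of_forall fun n => ?_)
    exact ENNReal.ofReal_le_one.2 ((hg n).le_one x)
  have hLt : ∀ x, L x < ⊤ := fun x => (hL1 x).trans_lt ENNReal.one_lt_top
  have hG : IsTest fun x => (L x).toReal :=
    ⟨hLm.ennreal_toReal, fun x => ENNReal.toReal_nonneg, fun x =>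
      ENNReal.toReal_le_of_le_ofReal zero_le_one (by simpa using hL1 x)⟩
  have hlint : ∀ (ν : Measure X) [IsProbabilityMeasure ν] (n : ℕ),
      ∫⁻ x, ENNReal.ofReal (g n x) ∂ν = ENNReal.ofReal (typeI ν (g n)) := fun ν _ n =>
    (ofReal_integral_eq_lintegral_ofReal ((hg n).integrable ν)
      (Eventually.of_forall (hg n).nonneg)).symm
  have hP0 : typeI P (fun x => (L x).toReal) = 0 := by
    have hsum : ∫⁻ x, ∑' n, ENNReal.ofReal (g n x) ∂P ≠ ⊤ := by
      rw [lintegral_tsum fun n => (hfm n).aemeasurable]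
      refine ne_top_of_le_ne_top (summable_geometric_two.tsum_ofReal_ne_top)
        (ENNReal.tsum_le_tsum fun n => ?_)
      rw [hlint]
      exact ENNReal.ofReal_le_ofReal (hgP n)
    apply integral_eq_zero_of_ae
    filter_upwards [ae_lt_top' (Measurable.tsum hfm).aemeasurable hsum] with x hx
    have := (ENNReal.tendsto_atTop_zero_of_tsum_ne_top hx.ne).limsup_eq
    simp [hL, this]
  have hQ : 1 - (tradeOff P Q 0 - ε) ≤ typeI Q (fun x => (L x).toReal) := by
    rw [typeI, integral_toReal hLm.aemeasurable (Eventually.of_forall hLt)]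
    have hfin : ∫⁻ x, L x ∂Q ≠ ⊤ := by
      refine ne_top_of_le_ne_top ENNReal.one_ne_top ((lintegral_mono hL1).trans ?_)
      simp
    refine (ENNReal.ofReal_le_iff_le_toReal hfin).1 ?_
    refine le_trans ?_ (limsup_lintegral_le (fun _ => 1) hfm
      (fun n => Eventually.of_forall fun x => ENNReal.ofReal_le_one.2 ((hg n).le_one x)) (by simp))
    refine le_limsup_of_frequently_le (Frequently.of_forall fun n => ?_)
    rw [hlint]
    refine ENNReal.ofReal_le_ofReal ?_
    have := hgQ n
    rw [typeII_eq (hg n)] at this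
    linarith
  have := tradeOff_le P Q hG hP0.le
  rw [typeII_eq hG] at this
  linarith

/-- A trade-off function is uniformly continuous; as it is decreasing, a bound from one side
suffices. Away from `0`, multiplying a test by `α / α'` lowers its type-I error from `α'` to `α` and
raises its type-II error by at most `(α' - α) / α'`. -/
theorem exists_tradeOff_le_add {ε : ℝ} (hε : 0 < ε) :
    ∃ δ > 0, ∀ α α' : ℝ, 0 ≤ α → α ≤ α' → α' ≤ α + δ →
      tradeOff P Q α ≤ tradeOff P Q α' + ε := by
  obtain ⟨δ, hδ, h0⟩ := exists_tradeOff_zero_le P Q hε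
  refine ⟨ε * δ, by positivity, fun α α' hα hle hclose => ?_⟩
  rcases le_total α' δ with h | h
  · have h1 := tradeOff_anti P Q le_rfl hα
    have h2 := tradeOff_anti P Q (hα.trans hle) h
    linarith
  · have hα' : 0 < α' := hδ.trans_le h
    rw [← sub_le_iff_le_add]
    refine le_tradeOff P Q hα'.le fun g hg hgα => ?_
    have hc0 : 0 ≤ α / α' := by positivity
    have hc1 : α / α' ≤ 1 := (div_le_one hα').2 hle
    have hc : 1 - α / α' ≤ ε := by
      rw [one_sub_div hα'.ne', div_le_iff₀ hα']
      nlinarith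
    have ht := hg.const_mul hc0 hc1
    have htI : ∀ ν : Measure X, typeI ν (fun x => α / α' * g x) = α / α' * typeI ν g := fun ν =>
      integral_const_mul _ _
    have h1 : tradeOff P Q α ≤ typeII Q fun x => α / α' * g x := by
      refine tradeOff_le P Q ht ?_
      rw [htI]
      calc α / α' * typeI P g ≤ α / α' * α' := by gcongr
        _ = α := div_mul_cancel₀ _ hα'.ne'
    rw [typeII_eq ht, htI] at h1
    rw [typeII_eq hg]
    nlinarith [typeI_le_one hg Q, typeI_nonneg hg Q]

end TradeOff

/-! ### The errors of the perturbed likelihood ratio test -/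

section Perturbed

variable {d : ℕ} {p q : EuclideanSpace ℝ (Fin d) → ℝ}

theorem IsContDensity.setIntegral_nonneg (hp : IsContDensity p)
    (s : Set (EuclideanSpace ℝ (Fin d))) : 0 ≤ ∫ y in s, p y :=
  integral_nonneg hp.nonneg

theorem IsContDensity.setIntegral_le_one (hp : IsContDensity p)
    (s : Set (EuclideanSpace ℝ (Fin d))) : ∫ y in s, p y ≤ 1 :=
  (setIntegral_le_integral hp.integrable (Eventually.of_forall hp.nonneg)).trans_eq
    hp.integral_eq_one

theorem antitone_setIntegral_rejectSet (hp : IsContDensity p) (hq : IsContDensity q) :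
    Antitone fun t => ∫ y in rejectSet p q t, q y := fun _ _ hst =>
  setIntegral_mono_set hq.integrable.integrableOn
    (Eventually.of_forall hq.nonneg) (rejectSet_anti hp hst).eventuallyLE

theorem integrableOn_average_of_antitone {F : ℝ → ℝ} (hF : Antitone F) (h η : ℝ) :
    IntegrableOn (fun x => (1 / h) * F (η + x)) (Icc (-h / 2) (h / 2)) := by
  refine Integrable.const_mul ?_ _
  refine AntitoneOn.integrableOn_isCompact isCompact_Icc ?_
  exact fun x _ y _ hxy => hF (by linarith)

theorem setIntegral_Icc_const {h : ℝ} (hh : 0 < h) (c : ℝ) :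
    ∫ _ in Icc (-h / 2) (h / 2), (1 / h) * c = c := by
  rw [setIntegral_const, Real.volume_real_Icc, max_eq_left (by linarith), smul_eq_mul]
  field_simp
  ring

theorem alphaPert_nonneg (hp : IsContDensity p) {h : ℝ} (hh : 0 < h) (η : ℝ) :
    0 ≤ alphaPert p q h η :=
  integral_nonneg fun _ => mul_nonneg (by positivity) (hp.setIntegral_nonneg _)

theorem alphaPert_le_one (hp : IsContDensity p) {h : ℝ} (hh : 0 < h) (η : ℝ) :
    alphaPert p q h η ≤ 1 := by
  rw [← setIntegral_Icc_const hh 1]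
  refine integral_mono (integrableOn_average_of_antitone (antitone_inner hp) h η)
    (integrable_const _) fun x => ?_
  exact mul_le_mul_of_nonneg_left (hp.setIntegral_le_one _) (by positivity)

theorem alphaPert_eq_intervalIntegral {h : ℝ} (hh : 0 < h) (η : ℝ) :
    alphaPert p q h η =
      (1 / h) * ∫ t in (η + -h / 2)..(η + h / 2), ∫ y in rejectSet p q t, p y := by
  rw [alphaPert, integral_Icc_eq_integral_Ioc, ← intervalIntegral.integral_of_le (by linarith),
    intervalIntegral.integral_const_mul,
    intervalIntegral.integral_comp_add_left (fun t => ∫ y in rejectSet p q t, p y)]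

theorem continuous_alphaPert (hp : IsContDensity p) {h : ℝ} (hh : 0 < h) :
    Continuous (alphaPert p q h) := by
  have hint : ∀ a b : ℝ, IntervalIntegrable (fun t => ∫ y in rejectSet p q t, p y) volume a b :=
    fun a b => (antitone_inner hp).intervalIntegrable
  have hc := intervalIntegral.continuous_primitive hint 0
  have he : alphaPert p q h = fun η =>
      (1 / h) * ((∫ t in (0 : ℝ)..(η + h / 2), ∫ y in rejectSet p q t, p y) -
        ∫ t in (0 : ℝ)..(η + -h / 2), ∫ y in rejectSet p q t, p y) := by
    funext η
    rw [alphaPert_eq_intervalIntegral hh,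
      intervalIntegral.integral_interval_sub_left (hint _ _) (hint _ _)]
  rw [he]
  exact continuous_const.mul ((hc.comp (continuous_id.add continuous_const)).sub
    (hc.comp (continuous_id.add continuous_const)))

/-- Markov's inequality for the likelihood ratio. -/
theorem mul_setIntegral_rejectSet_le_one (hp : IsContDensity p) (hq : IsContDensity q) (t : ℝ) :
    t * ∫ y in rejectSet p q t, p y ≤ 1 := by
  rw [← integral_const_mul]
  refine le_trans ?_ (hq.setIntegral_le_one (rejectSet p q t))
  refine setIntegral_mono_on (hp.integrable.const_mul t).integrableOn hq.integrable.integrableOn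
    (measurableSet_rejectSet hp hq t) fun y hy => le_of_lt hy

theorem alphaPert_le_of_le (hp : IsContDensity p) (hq : IsContDensity q) {h δ η : ℝ} (hh : 0 < h)
    (hδ : 0 < δ) (hη : 1 / δ + h / 2 ≤ η) : alphaPert p q h η ≤ δ := by
  rw [← setIntegral_Icc_const hh δ]
  refine setIntegral_mono_on (integrableOn_average_of_antitone (antitone_inner hp) h η)
    (integrable_const _) measurableSet_Icc fun x hx => ?_
  refine mul_le_mul_of_nonneg_left ?_ (by positivity)
  have ht : 1 / δ ≤ η + x := by linarith [hx.1]
  have hF := hp.setIntegral_nonneg (rejectSet p q (η + x))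
  have h1 := mul_setIntegral_rejectSet_le_one hp hq (η + x)
  have h2 := mul_le_mul_of_nonneg_right ht hF
  have h3 : 1 / δ * ∫ y in rejectSet p q (η + x), p y ≤ 1 := h2.trans h1
  rwa [one_div, inv_mul_le_iff₀ hδ, mul_one] at h3

/-- By the intermediate value theorem, thresholds `η ≥ 0` produce all positive levels up to the one
at `η = 0`. -/
theorem exists_alphaPert_eq (hp : IsContDensity p) (hq : IsContDensity q) {h α : ℝ} (hh : 0 < h)
    (hα : 0 < α) (hle : α ≤ alphaPert p q h 0) : ∃ η, 0 ≤ η ∧ alphaPert p q h η = α := by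
  have hM : (0 : ℝ) ≤ 1 / α + h / 2 := by positivity
  obtain ⟨η, hη, he⟩ := intermediate_value_Icc' hM (continuous_alphaPert (q := q) hp hh).continuousOn
    ⟨alphaPert_le_of_le hp hq hh hα le_rfl, hle⟩
  exact ⟨η, hη.1, he⟩

theorem betaPert_eq (hp : IsContDensity p) (hq : IsContDensity q) {h : ℝ} (hh : 0 < h) (η : ℝ) :
    betaPert p q h η =
      1 - ∫ x in Icc (-h / 2) (h / 2), (1 / h) * ∫ y in rejectSet p q (η + x), q y := by
  nth_rewrite 1 [← setIntegral_Icc_const hh 1]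
  rw [← integral_sub (integrable_const _)
    (integrableOn_average_of_antitone (antitone_setIntegral_rejectSet hp hq) h η), betaPert]
  refine integral_congr_ae (Eventually.of_forall fun x => ?_)
  have h1 := integral_add_compl (measurableSet_rejectSet hp hq (η + x)) hq.integrable
  rw [hq.integral_eq_one] at h1
  simp only [← mul_sub]
  rw [← h1, add_sub_cancel_left]

theorem IsContDensity.isProbabilityMeasure_distOf (hp : IsContDensity p) :
    IsProbabilityMeasure (distOf p) := by
  refine ⟨?_⟩
  rw [distOf, withDensity_apply _ MeasurableSet.univ, Measure.restrict_univ,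
    ← ofReal_integral_eq_lintegral_ofReal hp.integrable (Eventually.of_forall hp.nonneg),
    hp.integral_eq_one, ENNReal.ofReal_one]

theorem typeI_distOf (hp : IsContDensity p) (g : EuclideanSpace ℝ (Fin d) → ℝ) :
    typeI (distOf p) g = ∫ y, g y * p y := by
  rw [typeI, distOf, integral_withDensity_eq_integral_toReal_smul
    hp.continuous.measurable.ennreal_ofReal (Eventually.of_forall fun _ => ENNReal.ofReal_lt_top)]
  refine integral_congr_ae (Eventually.of_forall fun y => ?_)
  simp [ENNReal.toReal_ofReal (hp.nonneg y), mul_comm]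

theorem IsTest.integrable_mul {g f : EuclideanSpace ℝ (Fin d) → ℝ} (hg : IsTest g)
    (hf : Integrable f) : Integrable fun y => g y * f y := by
  refine hf.bdd_mul (c := 1) hg.measurable.aestronglyMeasurable (Eventually.of_forall fun y => ?_)
  rw [Real.norm_eq_abs, abs_of_nonneg (hg.nonneg y)]
  exact hg.le_one y

/-- The Neyman–Pearson inequality: no test `g` beats the likelihood ratio test with threshold `t`
for the loss `t * typeI + typeII`. -/
theorem neymanPearson (hp : IsContDensity p) (hq : IsContDensity q)
    {g : EuclideanSpace ℝ (Fin d) → ℝ} (hg : IsTest g) (t : ℝ) :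
    (∫ y, g y * q y) - t * ∫ y, g y * p y ≤
      (∫ y in rejectSet p q t, q y) - t * ∫ y in rejectSet p q t, p y := by
  have hR := measurableSet_rejectSet hp hq t
  have hgp := hg.integrable_mul hp.integrable
  have hgq := hg.integrable_mul hq.integrable
  rw [← integral_indicator hR, ← integral_indicator hR, ← integral_const_mul,
    ← integral_const_mul, ← integral_sub hgq (hgp.const_mul t),
    ← integral_sub (hq.integrable.indicator hR) ((hp.integrable.indicator hR).const_mul t)]
  refine integral_mono (hgq.sub (hgp.const_mul t))
    ((hq.integrable.indicator hR).sub ((hp.integrable.indicator hR).const_mul t)) fun y => ?_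
  by_cases hy : y ∈ rejectSet p q t
  · have hy' : t * p y < q y := hy
    simp only [indicator_of_mem hy]
    nlinarith [hg.le_one y]
  · have hy' : q y ≤ t * p y := not_lt.1 hy
    simp only [indicator_of_notMem hy]
    nlinarith [hg.nonneg y]

/-- The perturbed likelihood ratio test with threshold `η ≥ 0` is optimal up to `h / 2`: average the
Neyman–Pearson inequality over the thresholds `η + x`, where `|x| ≤ h / 2`. -/
theorem betaPert_le (hp : IsContDensity p) (hq : IsContDensity q) {h : ℝ} (hh : 0 < h) (η : ℝ)
    {g : EuclideanSpace ℝ (Fin d) → ℝ} (hg : IsTest g) :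
    betaPert p q h η ≤ 1 - (∫ y, g y * q y) +
      η * ((∫ y, g y * p y) - alphaPert p q h η) + h / 2 := by
  set A := ∫ y, g y * p y with hA
  set B := ∫ y, g y * q y with hB
  have hA0 : 0 ≤ A := integral_nonneg fun y => mul_nonneg (hg.nonneg y) (hp.nonneg y)
  have hA1 : A ≤ 1 := by
    rw [← hp.integral_eq_one]
    exact integral_mono (hg.integrable_mul hp.integrable) hp.integrable fun y =>
      mul_le_of_le_one_left (hp.nonneg y) (hg.le_one y)
  have hintp := integrableOn_average_of_antitone (antitone_inner (q := q) hp) h η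
  have hintq := integrableOn_average_of_antitone (antitone_setIntegral_rejectSet hp hq) h η
  have key : B - η * A - h / 2 ≤
      (∫ x in Icc (-h / 2) (h / 2), (1 / h) * ∫ y in rejectSet p q (η + x), q y) -
        η * alphaPert p q h η := by
    rw [← setIntegral_Icc_const hh (B - η * A - h / 2), alphaPert,
      ← integral_const_mul η (μ := volume.restrict (Icc (-h / 2) (h / 2))),
      ← integral_sub hintq (hintp.const_mul η)]
    refine setIntegral_mono_on (integrable_const _) (hintq.sub (hintp.const_mul η))
      measurableSet_Icc fun x hx => ?_
    have hnp := neymanPearson hp hq hg (η + x)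
    rw [← hA, ← hB] at hnp
    have hF0 := hp.setIntegral_nonneg (rejectSet p q (η + x))
    have hF1 := hp.setIntegral_le_one (rejectSet p q (η + x))
    set F := ∫ y in rejectSet p q (η + x), p y
    set G := ∫ y in rejectSet p q (η + x), q y
    have hx' : x * (A - F) ≤ h / 2 := by
      have h1 : |x| ≤ h / 2 := abs_le.2 ⟨by linarith [hx.1], hx.2⟩
      have h2 : |A - F| ≤ 1 := abs_le.2 ⟨by linarith, by linarith⟩
      calc x * (A - F) ≤ |x| * |A - F| := by rw [← abs_mul]; exact le_abs_self _
        _ ≤ h / 2 * 1 := mul_le_mul h1 h2 (abs_nonneg _) (by positivity)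
        _ = h / 2 := mul_one _
    have hmain : B - η * A - h / 2 ≤ G - η * F := by nlinarith
    calc 1 / h * (B - η * A - h / 2) ≤ 1 / h * (G - η * F) :=
          mul_le_mul_of_nonneg_left hmain (by positivity)
      _ = 1 / h * G - η * (1 / h * F) := by ring
  rw [betaPert_eq hp hq hh]
  linarith

/-- The perturbed likelihood ratio test as a randomized test: its rejection probability at `y` is
the probability, over the perturbation, of the event `y ∈ rejectSet p q (η + x)`. -/
def pertTest (p q : EuclideanSpace ℝ (Fin d) → ℝ) (h η : ℝ) (y : EuclideanSpace ℝ (Fin d)) : ℝ :=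
  ∫ x in Icc (-h / 2) (h / 2), (1 / h) * (rejectSet p q (η + x)).indicator (fun _ => 1) y

theorem measurable_indicator_rejectSet (hp : IsContDensity p) (hq : IsContDensity q) (η : ℝ) :
    Measurable fun z : EuclideanSpace ℝ (Fin d) × ℝ =>
      (rejectSet p q (η + z.2)).indicator (fun _ => (1 : ℝ)) z.1 := by
  have hs : MeasurableSet {z : EuclideanSpace ℝ (Fin d) × ℝ | (η + z.2) * p z.1 < q z.1} :=
    (isOpen_lt ((continuous_const.add continuous_snd).mul (hp.continuous.comp continuous_fst))
      (hq.continuous.comp continuous_fst)).measurableSet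
  exact (measurable_const (a := (1 : ℝ))).indicator hs

theorem isTest_pertTest (hp : IsContDensity p) (hq : IsContDensity q) {h : ℝ} (hh : 0 < h)
    (η : ℝ) : IsTest (pertTest p q h η) := by
  have hm := measurable_indicator_rejectSet hp hq η
  refine ⟨?_, fun y => ?_, fun y => ?_⟩
  · exact ((hm.const_mul (1 / h)).stronglyMeasurable.integral_prod_right
      (ν := volume.restrict (Icc (-h / 2) (h / 2)))).measurable
  · exact integral_nonneg fun x =>
      mul_nonneg (by positivity) (indicator_nonneg (fun _ _ => zero_le_one) _)
  · rw [← setIntegral_Icc_const hh 1]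
    refine integral_mono_of_nonneg (Eventually.of_forall fun x => ?_) (integrable_const _)
      (Eventually.of_forall fun x => ?_)
    · exact mul_nonneg (by positivity) (indicator_nonneg (fun _ _ => zero_le_one) _)
    · exact mul_le_mul_of_nonneg_left
        (indicator_le_self' (fun _ _ => zero_le_one) y) (by positivity)

theorem integral_pertTest_mul (hp : IsContDensity p) (hq : IsContDensity q) (h η : ℝ)
    {r : EuclideanSpace ℝ (Fin d) → ℝ} (hr : Integrable r) :
    ∫ y, pertTest p q h η y * r y =
      ∫ x in Icc (-h / 2) (h / 2), (1 / h) * ∫ y in rejectSet p q (η + x), r y := by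
  have hm := measurable_indicator_rejectSet hp hq η
  have hint : Integrable (Function.uncurry fun (y : EuclideanSpace ℝ (Fin d)) (x : ℝ) =>
      (rejectSet p q (η + x)).indicator (fun _ => (1 : ℝ)) y * (r y * (1 / h)))
      (volume.prod (volume.restrict (Icc (-h / 2) (h / 2)))) := by
    refine Integrable.bdd_mul (c := 1)
      (hr.mul_prod (integrable_const (μ := volume.restrict (Icc (-h / 2) (h / 2))) (1 / h)))
      hm.aestronglyMeasurable (Eventually.of_forall fun z => ?_)
    exact (norm_indicator_le_norm_self _ _).trans_eq norm_one
  calc ∫ y, pertTest p q h η y * r y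
      = ∫ y, ∫ x in Icc (-h / 2) (h / 2),
          (rejectSet p q (η + x)).indicator (fun _ => (1 : ℝ)) y * (r y * (1 / h)) := by
        refine integral_congr_ae (Eventually.of_forall fun y => ?_)
        simp only [pertTest]
        rw [← integral_mul_const]
        refine integral_congr_ae (Eventually.of_forall fun x => ?_)
        ring
    _ = ∫ x in Icc (-h / 2) (h / 2), ∫ y,
          (rejectSet p q (η + x)).indicator (fun _ => (1 : ℝ)) y * (r y * (1 / h)) :=
        integral_integral_swap hint
    _ = _ := by
        refine integral_congr_ae (Eventually.of_forall fun x => ?_)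
        simp only
        rw [← integral_indicator (measurableSet_rejectSet hp hq _), ← integral_const_mul]
        refine integral_congr_ae (Eventually.of_forall fun y => ?_)
        by_cases hy : y ∈ rejectSet p q (η + x)
        · simp [hy, mul_comm]
        · simp [hy]

end Perturbed

/-! ### Stability under perturbations of the densities in `L¹` -/

section Stability

variable {d : ℕ} {p q p' q' : EuclideanSpace ℝ (Fin d) → ℝ}

theorem abs_integral_test_mul_sub_le (hp : IsContDensity p) (hp' : IsContDensity p')
    {g : EuclideanSpace ℝ (Fin d) → ℝ} (hg : IsTest g) :
    |(∫ y, g y * p' y) - ∫ y, g y * p y| ≤ ∫ y, |p' y - p y| := by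
  rw [← integral_sub (hg.integrable_mul hp'.integrable) (hg.integrable_mul hp.integrable)]
  refine (abs_integral_le_integral_abs).trans (integral_mono
    ((hg.integrable_mul hp'.integrable).sub (hg.integrable_mul hp.integrable)).abs
    (hp'.integrable.sub hp.integrable).abs fun y => ?_)
  simp only
  rw [← mul_sub, abs_mul, abs_of_nonneg (hg.nonneg y)]
  exact mul_le_of_le_one_left (abs_nonneg _) (hg.le_one y)

/-- As both densities have integral `1`, their `L¹` distance is twice the integral of the positive
part of `p - p'`, which is at most `min p a`. -/
theorem integral_abs_sub_le (hp : IsContDensity p) (hp' : IsContDensity p') {a : ℝ} (ha : 0 ≤ a)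
    (h : ∀ y, |p' y - p y| ≤ a) : ∫ y, |p' y - p y| ≤ 2 * ∫ y, min (p y) a := by
  have hmin : Integrable fun y => min (p y) a := by
    refine hp.integrable.mono (hp.continuous.min continuous_const).aestronglyMeasurable
      (Eventually.of_forall fun y => ?_)
    rw [Real.norm_of_nonneg (le_min (hp.nonneg y) ha), Real.norm_of_nonneg (hp.nonneg y)]
    exact min_le_left _ _
  have h1 : ∫ y, |p' y - p y| ≤ ∫ y, ((p' y - p y) + 2 * min (p y) a) := by
    refine integral_mono (hp'.integrable.sub hp.integrable).abs
      ((hp'.integrable.sub hp.integrable).add (hmin.const_mul 2)) fun y => ?_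
    have h2 := abs_le.1 (h y)
    have h3 : p y - p' y ≤ min (p y) a := le_min (by linarith [hp'.nonneg y]) (by linarith)
    have h4 : 0 ≤ min (p y) a := le_min (hp.nonneg y) ha
    exact abs_le'.2 ⟨by linarith, by linarith⟩
  have h2 : ∫ y, ((p' y - p y) + 2 * min (p y) a) =
      (∫ y, (p' y - p y)) + ∫ y, 2 * min (p y) a :=
    integral_add (hp'.integrable.sub hp.integrable) (hmin.const_mul 2)
  rw [h2, integral_sub hp'.integrable hp.integrable, hp.integral_eq_one, hp'.integral_eq_one,
    sub_self, zero_add, integral_const_mul] at h1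
  exact h1

theorem tendsto_integral_min (hp : IsContDensity p) {a : ℕ → ℝ} (ha0 : ∀ n, 0 ≤ a n)
    (ha : Tendsto a atTop (𝓝 0)) : Tendsto (fun n => ∫ y, min (p y) (a n)) atTop (𝓝 0) := by
  rw [← integral_zero (EuclideanSpace ℝ (Fin d)) ℝ (μ := volume)]
  refine tendsto_integral_of_dominated_convergence p
    (fun n => (hp.continuous.min continuous_const).aestronglyMeasurable) hp.integrable
    (fun n => Eventually.of_forall fun y => ?_) (Eventually.of_forall fun y => ?_)
  · rw [Real.norm_of_nonneg (le_min (hp.nonneg y) (ha0 n))]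
    exact min_le_left _ _
  · have := (tendsto_const_nhds (x := p y)).min ha
    rwa [min_eq_right (hp.nonneg y)] at this

/-- The perturbed test for `p', q'`, seen as a test of `p` against `q`, cannot beat the trade-off
function of `p, q`. -/
theorem tradeOff_le_betaPert_add (hp : IsContDensity p) (hq : IsContDensity q)
    (hp' : IsContDensity p') (hq' : IsContDensity q') {h δ : ℝ} (hh : 0 < h)
    (hpp : ∫ y, |p' y - p y| ≤ δ) (hqq : ∫ y, |q' y - q y| ≤ δ) (η : ℝ) :
    tradeOff (distOf p) (distOf q) (alphaPert p' q' h η + δ) ≤ betaPert p' q' h η + δ := by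
  have := hq.isProbabilityMeasure_distOf
  have hg := isTest_pertTest hp' hq' hh η
  have h1 := abs_le.1 ((abs_integral_test_mul_sub_le hp hp' hg).trans hpp)
  have h2 := abs_le.1 ((abs_integral_test_mul_sub_le hq hq' hg).trans hqq)
  have hα : ∫ y, pertTest p' q' h η y * p' y = alphaPert p' q' h η :=
    integral_pertTest_mul hp' hq' h η hp'.integrable
  have hβ := integral_pertTest_mul hp' hq' h η hq'.integrable
  rw [betaPert_eq hp' hq' hh, ← hβ]
  refine (tradeOff_le _ _ hg ?_).trans ?_
  · rw [typeI_distOf hp]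
    linarith
  · rw [typeII_eq hg, typeI_distOf hq]
    linarith

/-- Above level `δ`, the perturbed test for `p', q'` is nearly optimal for testing `p` against
`q`: tests of level `α - δ` for `p` have level `α` for `p'`. -/
theorem betaPert_le_tradeOff_add (hp : IsContDensity p) (hq : IsContDensity q)
    (hp' : IsContDensity p') (hq' : IsContDensity q') {h δ η : ℝ} (hh : 0 < h)
    (hpp : ∫ y, |p' y - p y| ≤ δ) (hqq : ∫ y, |q' y - q y| ≤ δ) (hη : 0 ≤ η)
    (hα : δ ≤ alphaPert p' q' h η) :
    betaPert p' q' h η ≤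
      tradeOff (distOf p) (distOf q) (alphaPert p' q' h η - δ) + (δ + h / 2) := by
  have := hq.isProbabilityMeasure_distOf
  rw [← sub_le_iff_le_add]
  refine le_tradeOff _ _ (sub_nonneg.2 hα) fun g hg hgα => ?_
  rw [typeI_distOf hp] at hgα
  rw [typeII_eq hg, typeI_distOf hq]
  have h1 := abs_le.1 ((abs_integral_test_mul_sub_le hp hp' hg).trans hpp)
  have h2 := abs_le.1 ((abs_integral_test_mul_sub_le hq hq' hg).trans hqq)
  have h3 := betaPert_le hp' hq' hh η hg
  have h4 : η * ((∫ y, g y * p' y) - alphaPert p' q' h η) ≤ 0 :=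
    mul_nonpos_of_nonneg_of_nonpos hη (by linarith)
  linarith

theorem betaPert_zero_le (hp : IsContDensity p) (hq : IsContDensity q) {h : ℝ} (hh : 0 < h) :
    betaPert p q h 0 ≤ h / 2 := by
  have h1 := betaPert_le hp hq hh 0 (IsTest.const zero_le_one le_rfl)
  simp only [one_mul, hq.integral_eq_one] at h1
  linarith

end Stability

/-! ### Maximizers of the estimated gap -/

section Argmax

variable {d : ℕ} {p q : EuclideanSpace ℝ (Fin d) → ℝ} {X : Type*} [MeasurableSpace X]
  {P₀ Q₀ : Measure X} {T₀ : ℝ → ℝ}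

theorem bddAbove_range_gap [IsProbabilityMeasure Q₀]
    (hT₀ : EqOn T₀ (tradeOff P₀ Q₀) (Icc 0 1)) :
    BddAbove (range fun α : Icc (0 : ℝ) 1 => T₀ α - tradeOff (distOf p) (distOf q) α) := by
  refine ⟨1, ?_⟩
  rintro _ ⟨α, rfl⟩
  have h1 := tradeOff_le_one P₀ Q₀ α.2.1
  have h2 := tradeOff_nonneg (distOf p) (distOf q) α.2.1
  simp only
  rw [hT₀ α.2]
  linarith

/-- A maximizer of the estimated gap nearly maximizes the true gap, provided that the densities are
estimated well in `L¹` and the perturbation is small. At the maximizer, the estimated curve is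
bounded below by the true one; the reverse bound is needed only at the levels with which the
maximizer is compared. Those may be taken to be at least `δ`, which matters as the estimated curve
need not be close to the true one near level `0`. -/
theorem exists_abs_gap_sub_iSup_le [IsProbabilityMeasure P₀] [IsProbabilityMeasure Q₀]
    (hp : IsContDensity p) (hq : IsContDensity q)
    (hT₀ : EqOn T₀ (tradeOff P₀ Q₀) (Icc 0 1)) {ε : ℝ} (hε : 0 < ε) :
    ∃ δ > 0, ∀ (p' q' : EuclideanSpace ℝ (Fin d) → ℝ) (h η : ℝ),
      IsContDensity p' → IsContDensity q' → 0 < h → h ≤ δ →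
      ∫ y, |p' y - p y| ≤ δ → ∫ y, |q' y - q y| ≤ δ → η ∈ argmaxGap T₀ p' q' h →
      |T₀ (alphaPert p' q' h η) - tradeOff (distOf p) (distOf q) (alphaPert p' q' h η) -
        ⨆ α : Icc (0 : ℝ) 1, (T₀ α - tradeOff (distOf p) (distOf q) α)| ≤ 6 * ε := by
  have := hp.isProbabilityMeasure_distOf
  have := hq.isProbabilityMeasure_distOf
  set T := tradeOff (distOf p) (distOf q) with hT
  obtain ⟨δ₁, hδ₁, hmod⟩ := exists_tradeOff_le_add (distOf p) (distOf q) hε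
  obtain ⟨δ₂, hδ₂, hmod₀⟩ := exists_tradeOff_le_add P₀ Q₀ hε
  refine ⟨min (min δ₁ δ₂) (min ε 1), by positivity, ?_⟩
  set δ := min (min δ₁ δ₂) (min ε 1) with hδ
  have hδ0 : 0 < δ := by positivity
  have hδle₁ : δ ≤ δ₁ := (min_le_left _ _).trans (min_le_left _ _)
  have hδle₂ : δ ≤ δ₂ := (min_le_left _ _).trans (min_le_right _ _)
  have hδε : δ ≤ ε := (min_le_right _ _).trans (min_le_left _ _)
  have hδone : δ ≤ 1 := (min_le_right _ _).trans (min_le_right _ _)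
  intro p' q' h ηs hp' hq' hh hhδ hpp hqq hηs
  have hmem : ∀ η, alphaPert p' q' h η ∈ Icc (0 : ℝ) 1 := fun η =>
    ⟨alphaPert_nonneg hp' hh η, alphaPert_le_one hp' hh η⟩
  -- the estimated gap at a competitor is at most the true gap at the maximizer
  have hcomp : ∀ η, 0 ≤ η → T₀ (alphaPert p' q' h η) - betaPert p' q' h η ≤
      T₀ (alphaPert p' q' h ηs) - T (alphaPert p' q' h ηs) + 2 * ε := by
    intro η hη
    have h1 := hηs.2 η hη
    rw [tradeOffPert_alphaPert hp' hq' hh, tradeOffPert_alphaPert hp' hq' hh] at h1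
    have h2 := tradeOff_le_betaPert_add hp hq hp' hq' hh hpp hqq ηs
    have h3 := hmod _ (alphaPert p' q' h ηs + δ) (hmem ηs).1 (by linarith) (by linarith)
    linarith
  have hge : ∀ α ∈ Icc (0 : ℝ) 1, δ ≤ α →
      T₀ α - T α ≤ T₀ (alphaPert p' q' h ηs) - T (alphaPert p' q' h ηs) + 5 * ε := by
    intro α hα hδα
    rcases le_total (alphaPert p' q' h 0) α with hle | hle
    · -- no threshold `η ≥ 0` gives a level above that of `η = 0`, where the test has full power
      have h1 := hcomp 0 le_rfl
      have h2 := betaPert_zero_le hp' hq' hh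
      have h3 := tradeOff_anti P₀ Q₀ (hmem 0).1 hle
      rw [← hT₀ (hmem 0), ← hT₀ hα] at h3
      have h4 := tradeOff_nonneg (distOf p) (distOf q) hα.1
      rw [← hT] at h4
      linarith
    · obtain ⟨η, hη, rfl⟩ := exists_alphaPert_eq hp' hq' hh (hδ0.trans_le hδα) hle
      have h1 := hcomp η hη
      have h2 := betaPert_le_tradeOff_add hp hq hp' hq' hh hpp hqq hη hδα
      have h3 := hmod (alphaPert p' q' h η - δ) (alphaPert p' q' h η) (sub_nonneg.2 hδα)
        (by linarith) (by linarith)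
      linarith
  have hall : ∀ α ∈ Icc (0 : ℝ) 1,
      T₀ α - T α ≤ T₀ (alphaPert p' q' h ηs) - T (alphaPert p' q' h ηs) + 6 * ε := by
    intro α hα
    have hα' : max α δ ∈ Icc (0 : ℝ) 1 := ⟨hα.1.trans (le_max_left _ _), max_le hα.2 hδone⟩
    have h1 := hge _ hα' (le_max_right _ _)
    have h2 := tradeOff_anti (distOf p) (distOf q) hα.1 (le_max_left α δ)
    have h3 := hmod₀ α (max α δ) hα.1 (le_max_left _ _)
      (max_le (by linarith) (by linarith [hα.1]))
    rw [← hT₀ hα, ← hT₀ hα'] at h3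
    rw [← hT] at h2
    linarith
  have hsup := le_ciSup (bddAbove_range_gap (p := p) (q := q) hT₀) ⟨_, hmem ηs⟩
  have hsup' : ⨆ α : Icc (0 : ℝ) 1, (T₀ α - T α) ≤
      T₀ (alphaPert p' q' h ηs) - T (alphaPert p' q' h ηs) + 6 * ε :=
    ciSup_le fun α => hall α α.2
  exact abs_le.2 ⟨by linarith, by simp only at hsup; linarith⟩

end Argmax

end FDP

end

/-! ### Convergence in probability -/

theorem abs_sub_le_of_iSup_ofReal_le {Y : Type*} {f g : Y → ℝ} {a : ℝ} (ha : 0 ≤ a)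
    (h : ⨆ y, ENNReal.ofReal |f y - g y| ≤ ENNReal.ofReal a) (y : Y) : |f y - g y| ≤ a :=
  (ENNReal.ofReal_le_ofReal_iff ha).1
    ((le_iSup (fun y => ENNReal.ofReal |f y - g y|) y).trans h)

theorem mainTheorem4 {d : ℕ}
    -- the true densities
    (p q : EuclideanSpace ℝ (Fin d) → ℝ)
    (hp : FDP.IsContDensity p) (hq : FDP.IsContDensity q)
    (hfin : (FDP.plateauValues p q).Finite)
    -- the density estimators
    {Ω : Type*} [MeasurableSpace Ω] (μ : Measure Ω) [IsProbabilityMeasure μ]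
    (phat qhat : ℕ → Ω → EuclideanSpace ℝ (Fin d) → ℝ)
    (a : ℕ → ℝ) (ha_nonneg : ∀ n, 0 ≤ a n) (ha : Tendsto a atTop (𝓝 0))
    (hphat : FDP.IsDensityEstimator μ phat p a)
    (hqhat : FDP.IsDensityEstimator μ qhat q a)
    -- the perturbation parameter; the last condition is `h n / a n → ∞`, where `a n = 0` is allowed
    (h : ℕ → ℝ) (hh_pos : ∀ n, 0 < h n) (hh : Tendsto h atTop (𝓝 0))
    (hah : Tendsto (fun n => a n / h n) atTop (𝓝 0))
    -- the claimed trade-off curve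
    {X : Type*} [MeasurableSpace X] (P₀ Q₀ : Measure X)
    [IsProbabilityMeasure P₀] [IsProbabilityMeasure Q₀]
    (T₀ : ℝ → ℝ) (hT₀ : EqOn T₀ (FDP.tradeOff P₀ Q₀) (Icc 0 1))
    -- the estimated threshold
    (etaStar : ℕ → Ω → ℝ)
    (hetaStar : Tendsto
      (fun n => μ {ω | etaStar n ω ∉ FDP.argmaxGap T₀ (phat n ω) (qhat n ω) (h n)})
      atTop (𝓝 0)) :
    TendstoInMeasure μ
      (fun n ω =>
        T₀ (FDP.alphaPert (phat n ω) (qhat n ω) (h n) (etaStar n ω)) -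
          FDP.tradeOff (FDP.distOf p) (FDP.distOf q)
            (FDP.alphaPert (phat n ω) (qhat n ω) (h n) (etaStar n ω)))
      atTop
      (fun _ => ⨆ α : Icc (0 : ℝ) 1,
        (T₀ α - FDP.tradeOff (FDP.distOf p) (FDP.distOf q) α)) := by
  rw [tendstoInMeasure_iff_dist]
  intro ε hε
  obtain ⟨δ, hδ, hdet⟩ := FDP.exists_abs_gap_sub_iSup_le hp hq hT₀ (show 0 < ε / 12 by positivity)
  have hsmall : ∀ᶠ n in atTop, h n ≤ δ ∧ 2 * ∫ y, min (p y) (a n) ≤ δ ∧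
      2 * ∫ y, min (q y) (a n) ≤ δ := by
    have h1 := (FDP.tendsto_integral_min hp ha_nonneg ha).const_mul 2
    have h2 := (FDP.tendsto_integral_min hq ha_nonneg ha).const_mul 2
    rw [mul_zero] at h1 h2
    exact (hh.eventually_le_const hδ).and
      ((h1.eventually_le_const hδ).and (h2.eventually_le_const hδ))
  have hbad := (hphat.rate.add hqhat.rate).add hetaStar
  simp only [add_zero] at hbad
  refine tendsto_of_tendsto_of_tendsto_of_le_of_le' tendsto_const_nhds hbad
    (Eventually.of_forall fun _ => zero_le) ?_
  filter_upwards [hsmall] with n hn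
  refine le_trans (measure_mono fun ω hω => ?_)
    ((measure_union_le _ _).trans (add_le_add_left (measure_union_le _ _) _))
  -- an outcome outside all three exceptional events satisfies the deterministic bound
  by_contra hgood
  simp only [mem_union, mem_ofPred_eq, not_or, not_lt, not_not] at hgood
  obtain ⟨⟨hpn, hqn⟩, hηn⟩ := hgood
  have hp' := hphat.density n ω
  have hq' := hqhat.density n ω
  have hpp := (FDP.integral_abs_sub_le hp hp' (ha_nonneg n)
    (abs_sub_le_of_iSup_ofReal_le (ha_nonneg n) hpn)).trans hn.2.1
  have hqq := (FDP.integral_abs_sub_le hq hq' (ha_nonneg n)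
    (abs_sub_le_of_iSup_ofReal_le (ha_nonneg n) hqn)).trans hn.2.2
  have hd := hdet _ _ _ _ hp' hq' (hh_pos n) hn.1 hpp hqq hηn
  have hω' : ε ≤ _ := hω
  rw [Real.dist_eq] at hω'
  linarith
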